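/- Let $\Sigma$ be a finite alphabet. For $w\in\Sigma^*$ let $\mathsf{Facs}(w)$ be the set of factors (contiguous subwords) of $w$, and let $\mathfrak{A}_w$ be the structure with universe $\mathsf{Facs}(w)\cup\{\perp\}$, with the ternary relation $R_\circ^{\mathfrak{A}_w}=\{(x,y,z)\in\mathsf{Facs}(w)^3 \mid x=y\cdot z\}$, with a constant symbol for every letter $\mathtt{b}\in\Sigma$, interpreted as the word $\mathtt{b}$ if $\mathtt{b}$ occurs in $w$ and as $\perp$ otherwise, and with a constant symbol $\varepsilon$, interpreted as the empty word. For $w,v\in\Sigma^*$ and $k\in\mathbb{N}=\{0,1,2,\dots\}$, the $k$-round Ehrenfeucht–Fraïssé game on $\mathfrak{A}_w$ and $\mathfrak{A}_v$ is played as follows. In round $i=1,\dots,k$ Spoiler chooses one of the two structures and an element of its universe (possibly $\perp$), and Duplicator answers with an element of the universe of the other structure; let $a_i$ be the element chosen in $\mathfrak{A}_w$ and $b_i$ the one chosen in $\mathfrak{A}_v$. Let $\vec a$ and $\vec b$ be the tuples of the chosen elements, extended by the interpretations of all constant symbols in $\mathfrak{A}_w$ and in $\mathfrak{A}_v$, respectively.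 Duplicator wins if $(\vec a,\vec b)$ is a partial isomorphism, that is, if for all indices $i,j,l$ and every constant symbol $c$: $a_i=c^{\mathfrak{A}_w}$ iff $b_i=c^{\mathfrak{A}_v}$; $a_i=a_j$ iff $b_i=b_j$; and $(a_i,a_j,a_l)\in R_\circ^{\mathfrak{A}_w}$ iff $(b_i,b_j,b_l)\in R_\circ^{\mathfrak{A}_v}$. Write $w\equiv_k v$ if Duplicator has a winning strategy in this game. **Lemma.** Let $\mathtt{a}\in\Sigma$. For every $k\in\mathbb{N}$ there exist $p,q\in\mathbb{N}$ with $p\neq q$ and $\mathtt{a}^p\equiv_k\mathtt{a}^q$. -/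

import Mathlib

/-!
Words over an alphabet `α` are lists over `α`, and `u <:+: w` (`List.IsInfix`) says that `u` is a
factor of `w`.
-/

namespace FCGame

/-- The constant symbols of the signature `τ_α`: one for every letter, and one for the empty
word. -/
inductive ConstSymbol (α : Type*) where
  | letter (a : α) : ConstSymbol α
  | eps : ConstSymbol α

/-- The universe `Facs(w) ∪ {⊥}` of the structure that represents the word `w`;
here `none` plays the role of `⊥`. -/
abbrev Universe {α : Type*} (w : List α) : Type _ :=
  Option {u : List α // u <:+: w}

/-- The ternary relation `R_∘` of the structure that represents `w`: all `(x, y, z)` such that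
`x`, `y`, `z` are factors of `w` (so none of them is `⊥`) and `x = y · z`. -/
def Concat {α : Type*} (w : List α) : Universe w → Universe w → Universe w → Prop
  | some x, some y, some z => x.1 = y.1 ++ z.1
  | _, _, _ => False

open Classical in
/-- The interpretation of the constant symbols in the structure that represents `w`: the symbol of
a letter `a` is interpreted by the one-letter word `a` if `a` occurs in `w`, and by `⊥` otherwise;
the symbol `ε` is interpreted by the empty word. -/
noncomputable def const {α : Type*} (w : List α) : ConstSymbol α → Universe w
  | .letter a => if h : a ∈ w then some ⟨[a], List.singleton_infix_iff a w |>.mpr h⟩ else none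
  | .eps => some ⟨[], List.nil_infix⟩

/-- The pair of tuples `(a, b)`, indexed by `ι`, defines a partial isomorphism between the
structures that represent `w` and `v`. -/
structure IsPartialIso {α : Type*} (w v : List α) {ι : Type*}
    (a : ι → Universe w) (b : ι → Universe v) : Prop where
  const_iff : ∀ (i : ι) (c : ConstSymbol α), a i = const w c ↔ b i = const v c
  eq_iff : ∀ i j : ι, a i = a j ↔ b i = b j
  concat_iff : ∀ i j k : ι, Concat w (a i) (a j) (a k) ↔ Concat v (b i) (b j) (b k)

/-- A move of Spoiler: the choice of one of the two structures and of an element of it. -/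
abbrev Move {α : Type*} (w v : List α) : Type _ :=
  Universe w ⊕ Universe v

/-- The rounds played so far: the list of the pairs `(a_i, b_i)` of chosen elements, in order. -/
abbrev History {α : Type*} (w v : List α) : Type _ :=
  List (Universe w × Universe v)

/-- A strategy of Duplicator: given the rounds played so far and the current move of Spoiler,
it picks an element of the structure that Spoiler has not chosen. -/
structure Strategy {α : Type*} (w v : List α) where
  respondRight : History w v → Universe w → Universe v
  respondLeft : History w v → Universe v → Universe w

/-- The pair of elements chosen in the round that follows the history `h`, when Spoiler makes
the move `m` and Duplicator plays by `S`. -/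
def Strategy.round {α : Type*} {w v : List α} (S : Strategy w v) (h : History w v) :
    Move w v → Universe w × Universe v
  | .inl x => (x, S.respondRight h x)
  | .inr y => (S.respondLeft h y, y)

/-- The history that results when Spoiler makes the moves `ms`, in this order, and Duplicator
plays by `S`. -/
def Strategy.play {α : Type*} {w v : List α} (S : Strategy w v) (ms : List (Move w v)) :
    History w v :=
  ms.foldl (fun h m => h ++ [S.round h m]) []

/-- Duplicator has won the game whose chosen elements are `h`: the tuples of the chosen elements,
extended by the tuples of all constants, define a partial isomorphism. -/
def DuplicatorWins {α : Type*} {w v : List α} (h : History w v) : Prop :=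
  IsPartialIso w v (ι := Fin h.length ⊕ ConstSymbol α)
    (Sum.elim (fun i => (h.get i).1) (const w))
    (Sum.elim (fun i => (h.get i).2) (const v))

/-- `w ≡_k v`: Duplicator has a winning strategy for the `k`-round game over the structures that
represent `w` and `v`. -/
def GameEquiv {α : Type*} (k : ℕ) (w v : List α) : Prop :=
  ∃ S : Strategy w v, ∀ ms : List (Move w v), ms.length = k → DuplicatorWins (S.play ms)

end FCGame

namespace FCGame

/-! The proof is a pigeonhole argument on rank-`k` types. The signature is finite and relational
apart from constants, so only finitely many rank-`k` types exist (`RankType.finite`), and two of the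
infinitely many words `a^n` share one. Words of equal rank-`k` type are `k`-round equivalent
(`gameEquiv_of_rankType_eq`): Duplicator keeps the types of the chosen tuples equal, at the rank
given by the remaining rounds. Nothing about the words `a^n` is used beyond there being one for each
`n`, so no explicit `p`, `q` result. -/

instance ConstSymbol.finite {α : Type*} [Finite α] : Finite (ConstSymbol α) := by
  refine Finite.of_injective
    (fun c : ConstSymbol α => match c with
      | .letter a => some a
      | .eps => none) ?_
  rintro (a | _) (b | _) h <;> simp_all

/-- The rank-`k` types of `n`-tuples: at rank zero, the atomic types of the tuple extended by the
constants, and at rank `k + 1`, sets of rank-`k` types of `(n + 1)`-tuples. -/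
def RankType (α : Type*) : ℕ → ℕ → Type _
  | 0, n => (Fin n ⊕ ConstSymbol α → Fin n ⊕ ConstSymbol α → Prop) ×
      (Fin n ⊕ ConstSymbol α → Fin n ⊕ ConstSymbol α → Fin n ⊕ ConstSymbol α → Prop)
  | k + 1, n => Set (RankType α k (n + 1))

/-- Atomic types are predicates on a finite index set, and a finite type has finitely many subsets.
`RankType` does not mention the word, so a single finite set serves all structures. -/
theorem RankType.finite (α : Type*) [Finite α] (k n : ℕ) : Finite (RankType α k n) := by
  induction k generalizing n with
  | zero => unfold RankType; infer_instance
  | succ k ih =>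
    have := ih (n + 1)
    unfold RankType
    infer_instance

/-- The first `n` entries of the list `l`, extended by the constants. -/
noncomputable def tuple {α : Type*} {w : List α} (n : ℕ) (l : List (Universe w)) :
    Fin n ⊕ ConstSymbol α → Universe w :=
  Sum.elim (fun i => l.getD i none) (const w)

/-- The rank-`k` type of the `n`-tuple `l` in the structure that represents `w`. -/
noncomputable def rankType {α : Type*} {w : List α} :
    (k n : ℕ) → List (Universe w) → RankType α k n
  | 0, n, l => (fun i j => tuple n l i = tuple n l j,
      fun i j m => Concat w (tuple n l i) (tuple n l j) (tuple n l m))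
  | k + 1, n, l => Set.range fun x : Universe w => rankType k (n + 1) (l ++ [x])

theorem duplicatorWins_of_rankType_zero_eq {α : Type*} {w v : List α} (h : History w v)
    (e : rankType 0 h.length (h.map Prod.fst) = rankType 0 h.length (h.map Prod.snd)) :
    DuplicatorWins h := by
  have e₁ : tuple h.length (h.map Prod.fst) =
      Sum.elim (fun i => (h.get i).1) (const w) := by
    -- The default `none` in `tuple` is never reached: the list has length `h.length`.
    funext i; cases i <;> simp [tuple]
  have e₂ : tuple h.length (h.map Prod.snd) =
      Sum.elim (fun i => (h.get i).2) (const v) := by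
    funext i; cases i <;> simp [tuple]
  simp only [rankType, e₁, e₂] at e
  obtain ⟨heq, hconcat⟩ := Prod.mk.inj e
  have eq_iff := fun i j => iff_of_eq (congrFun (congrFun heq i) j)
  -- Constants are entries of the extended tuple, so the condition on constants is an instance of
  -- the one on equalities.
  exact ⟨fun i c => eq_iff i (.inr c), eq_iff,
    fun i j m => iff_of_eq (congrFun (congrFun (congrFun hconcat i) j) m)⟩

/-- The "forth" property; "back" is the same lemma applied to the symmetric equality. -/
theorem exists_rankType_append_eq {α : Type*} {w v : List α} {k n : ℕ}
    {l : List (Universe w)} {l' : List (Universe v)}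
    (e : rankType (k + 1) n l = rankType (k + 1) n l') (x : Universe w) :
    ∃ y : Universe v, rankType k (n + 1) (l ++ [x]) = rankType k (n + 1) (l' ++ [y]) := by
  have e' : (Set.range fun x : Universe w => rankType k (n + 1) (l ++ [x])) =
      Set.range fun y : Universe v => rankType k (n + 1) (l' ++ [y]) := e
  have hx : rankType k (n + 1) (l ++ [x]) ∈
      Set.range fun y : Universe v => rankType k (n + 1) (l' ++ [y]) := e' ▸ Set.mem_range_self x
  obtain ⟨y, hy⟩ := hx
  exact ⟨y, hy.symm⟩

/-- Duplicator's strategy in the `k`-round game that preserves the equality of the types whose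
rank is the number of remaining rounds. -/
noncomputable def typeStrategy {α : Type*} (k : ℕ) (w v : List α) : Strategy w v where
  respondRight h x := Classical.epsilon fun y =>
    rankType (k - (h.length + 1)) (h.length + 1) (h.map Prod.fst ++ [x]) =
      rankType (k - (h.length + 1)) (h.length + 1) (h.map Prod.snd ++ [y])
  respondLeft h y := Classical.epsilon fun x =>
    rankType (k - (h.length + 1)) (h.length + 1) (h.map Prod.snd ++ [y]) =
      rankType (k - (h.length + 1)) (h.length + 1) (h.map Prod.fst ++ [x])

theorem Strategy.play_append_singleton {α : Type*} {w v : List α} (S : Strategy w v)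
    (ms : List (Move w v)) (m : Move w v) :
    S.play (ms ++ [m]) = S.play ms ++ [S.round (S.play ms) m] := by
  simp [Strategy.play]

theorem Strategy.length_play {α : Type*} {w v : List α} (S : Strategy w v)
    (ms : List (Move w v)) : (S.play ms).length = ms.length := by
  induction ms using List.reverseRecOn with
  | nil => rfl
  | append_singleton ms m ih => simp [S.play_append_singleton, ih]

theorem typeStrategy_round {α : Type*} {k : ℕ} {w v : List α} {h : History w v}
    (hk : h.length < k)
    (e : rankType (k - h.length) h.length (h.map Prod.fst) =
      rankType (k - h.length) h.length (h.map Prod.snd)) (m : Move w v) :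
    rankType (k - (h.length + 1)) (h.length + 1)
        (h.map Prod.fst ++ [((typeStrategy k w v).round h m).1]) =
      rankType (k - (h.length + 1)) (h.length + 1)
        (h.map Prod.snd ++ [((typeStrategy k w v).round h m).2]) := by
  -- A round remains, so the truncated subtraction yields a successor rank.
  rw [show k - h.length = k - (h.length + 1) + 1 by omega] at e
  cases m with
  | inl x => exact Classical.epsilon_spec (exists_rankType_append_eq e x)
  | inr y => exact (Classical.epsilon_spec (exists_rankType_append_eq e.symm y)).symm

theorem typeStrategy_play {α : Type*} {k : ℕ} {w v : List α}
    (e : rankType k 0 ([] : List (Universe w)) = rankType k 0 ([] : List (Universe v)))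
    (ms : List (Move w v)) (hms : ms.length ≤ k) :
    rankType (k - ms.length) ms.length (((typeStrategy k w v).play ms).map Prod.fst) =
      rankType (k - ms.length) ms.length (((typeStrategy k w v).play ms).map Prod.snd) := by
  induction ms using List.reverseRecOn with
  | nil => exact e
  | append_singleton ms m ih =>
    rw [List.length_append, List.length_singleton] at hms ⊢
    have hlen := (typeStrategy k w v).length_play ms
    have hround := typeStrategy_round (k := k) (h := (typeStrategy k w v).play ms)
      (by omega) (by rw [hlen]; exact ih (by omega)) m
    rw [hlen] at hround
    simpa only [Strategy.play_append_singleton, List.map_append, List.map_cons, List.map_nil]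
      using hround

theorem gameEquiv_of_rankType_eq {α : Type*} {k : ℕ} {w v : List α}
    (e : rankType k 0 ([] : List (Universe w)) = rankType k 0 ([] : List (Universe v))) :
    GameEquiv k w v := by
  refine ⟨typeStrategy k w v, fun ms hms => duplicatorWins_of_rankType_zero_eq _ ?_⟩
  have h := typeStrategy_play e ms hms.le
  rw [Strategy.length_play]
  rwa [show k - ms.length = 0 by omega] at h

end FCGame

theorem mainTheorem8 {α : Type*} [Finite α] (a : α) (k : ℕ) :
    ∃ p q : ℕ, p ≠ q ∧
      FCGame.GameEquiv k (List.replicate p a) (List.replicate q a) := by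
  have := FCGame.RankType.finite α k 0
  obtain ⟨p, q, hne, e⟩ := Finite.exists_ne_map_eq_of_infinite fun n : ℕ =>
    FCGame.rankType k 0 ([] : List (FCGame.Universe (List.replicate n a)))
  exact ⟨p, q, hne, FCGame.gameEquiv_of_rankType_eq e⟩
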